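/- Let $0<q<1$. For $a\in\mathbb C$ put $(a;q)_\infty=\prod_{k\ge 0}(1-aq^k)$; for an integer $n\ge 0$ put $(a;q)_n=\prod_{k=0}^{n-1}(1-aq^k)$ and $(a;q)_{-n}=1/\prod_{k=1}^{n}(1-aq^{-k})$; and write $(a_1,\dots,a_r;q)_n=(a_1;q)_n\cdots(a_r;q)_n$ for $n\in\mathbb Z\cup\{\infty\}$. Let $${}_r\psi_r\left(\begin{matrix}a_1,\dots,a_r\\ b_1,\dots,b_r\end{matrix};q,z\right)=\sum_{n=-\infty}^{\infty}\frac{(a_1,\dots,a_r;q)_n}{(b_1,\dots,b_r;q)_n}\,z^n .$$ Let $\alpha\in\mathbb R\setminus\{0\}$ and let $t_1,t_2\in\mathbb C\setminus\{0\}$ be such that $t_j\alpha q^k\neq 1$ and $-t_jq^k/\alpha\neq 1$ for $j=1,2$ and all integers $k\ge 0$ (so that all terms below are well defined). (i) For every $\beta>0$ with $|t_1t_2\beta/q|<1$ the following series converges absolutely and $${}_6\psi_6\left(\begin{matrix} i\alpha q,-i\alpha q,i\alpha/\sqrt\beta,-i\alpha/\sqrt\beta,-\alpha q/t_1,-\alpha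 q/t_2\\ i\alpha,-i\alpha,i\alpha\sqrt\beta q,-i\alpha\sqrt\beta q,t_1\alpha,t_2\alpha\end{matrix};q,\frac{t_1t_2\beta}{q}\right)$$ $$=\frac{(it_1\sqrt\beta,-it_1\sqrt\beta,it_2\sqrt\beta,-it_2\sqrt\beta,-t_1t_2/q,-\alpha^2q,-q/\alpha^2,-\beta q,q;q)_\infty}{(t_1\alpha,t_2\alpha,-t_1/\alpha,-t_2/\alpha,t_1t_2\beta/q,i\alpha\sqrt\beta q,-i\alpha\sqrt\beta q,i\sqrt\beta q/\alpha,-i\sqrt\beta q/\alpha;q)_\infty}.$$ (ii) If $|t_1t_2/q^2|<1$, the following series converges absolutely and $${}_4\psi_4\left(\begin{matrix} i\alpha q,-i\alpha q,-\alpha q/t_1,-\alpha q/t_2\\ i\alpha,-i\alpha,\alpha t_1,\alpha t_2\end{matrix};q,-\frac{t_1t_2}{q^2}\right)=0.$$ -/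

import Mathlib

/-- The infinite `q`-shifted factorial `(a; q)_∞ = ∏_{k ≥ 0} (1 - a q ^ k)`
(the product converges absolutely for `|q| < 1`). -/
noncomputable def qShiftedInf (a q : ℂ) : ℂ := ∏' k : ℕ, (1 - a * q ^ k)

/-- The product `(a₁, …, aᵣ; q)_∞ = (a₁; q)_∞ ⋯ (aᵣ; q)_∞`. -/
noncomputable def qShiftedInfList (as : List ℂ) (q : ℂ) : ℂ :=
  (as.map fun a => qShiftedInf a q).prod

/-- The `q`-shifted factorial `(a; q)_n` for an integer `n`: it is `∏_{0 ≤ k < n} (1 - a q ^ k)`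
for `n ≥ 0`, and `(a; q)_{-m} = 1 / ∏_{1 ≤ k ≤ m} (1 - a q ^ (-k))` for `m ≥ 1`. -/
noncomputable def qShifted (a q : ℂ) : ℤ → ℂ
  | Int.ofNat n => ∏ k ∈ Finset.range n, (1 - a * q ^ k)
  | Int.negSucc m => (∏ k ∈ Finset.range (m + 1), (1 - a * q ^ (-((k : ℤ) + 1))))⁻¹

/-- The product `(a₁, …, aᵣ; q)_n = (a₁; q)_n ⋯ (aᵣ; q)_n`, for an integer `n`. -/
noncomputable def qShiftedList (as : List ℂ) (q : ℂ) (n : ℤ) : ℂ :=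
  (as.map fun a => qShifted a q n).prod

/-- The `n`-th term of the bilateral basic hypergeometric series `ᵣψₛ(as; bs; q, z)`, namely
`(a₁, …, aᵣ; q)_n / (b₁, …, bₛ; q)_n * ((-1) ^ n * q ^ (n (n - 1) / 2)) ^ (s - r) * z ^ n`. -/
noncomputable def qPsiTerm (as bs : List ℂ) (q z : ℂ) (n : ℤ) : ℂ :=
  qShiftedList as q n / qShiftedList bs q n *
    ((-1) ^ n * q ^ (n * (n - 1) / 2)) ^ ((bs.length : ℤ) - (as.length : ℤ)) * z ^ n

/-- The bilateral basic hypergeometric series `ᵣψₛ(as; bs; q, z)`, summed over all integers. -/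
noncomputable def qPsi (as bs : List ℂ) (q z : ℂ) : ℂ :=
  ∑' n : ℤ, qPsiTerm as bs q z n

section BilateralSummation

open Filter Topology Finset

/-! Both parts are cases of Bailey's very-well-poised ₆ψ₆ sum with a = (iα)² = -α². It is proved in
the reciprocals x, y, z, w of the four free parameters, so that sending a parameter to infinity
becomes setting a variable to 0.

Write S for the bilateral sum, N and D for the numerator and denominator products that depend on x,
y, z, w. Replacing x by qx changes S by an explicit rational factor: a combination of the two
summands is a difference of a certificate (`veryWellPoisedTerm_contiguous`), and such a difference
sums to 0 over ℤ. The products N and D obey matching relations, so S·D and N acquire the same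
factor. Shifting all four variables M times and letting M → ∞, by dominated convergence, gives S·D =
S(0,0,0,0)·N (`veryWellPoisedSum_mul_denom`).

The constant S(0,0,0,0) does not depend on the variables, so one computable case determines it: at x
= 1, y = 1/a, z = w = 0 only the term n = 0 survives. This yields the triple product
(`veryWellPoisedSum_zero`) and then `veryWellPoisedSum_eq`.

Part (i) is a substitution. For part (ii), two variables with aqxy = 1 drop out of the summand up to
a power (`wellPoisedFactor_mul_eq`), which leaves the ₄ψ₄, while N contains (aqxy; q)_∞ = (1; q)_∞ =
0. -/

/-! ### Infinite q-shifted factorials and growth of partial products -/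

theorem summable_norm_qShifted_factor {q : ℂ} (hq : ‖q‖ < 1) (a : ℂ) :
    Summable fun k : ℕ => ‖-(a * q ^ k)‖ := by
  simpa using (summable_geometric_of_lt_one (norm_nonneg q) hq).mul_left ‖a‖

theorem qShiftedInf_eq_mul {q : ℂ} (hq : ‖q‖ < 1) (a : ℂ) :
    qShiftedInf a q = (1 - a) * qShiftedInf (q * a) q := by
  have hs : Multipliable fun k : ℕ => 1 + -(q * a * q ^ k) :=
    multipliable_one_add_of_summable (summable_norm_qShifted_factor hq (q * a))
  unfold qShiftedInf
  rw [tprod_eq_zero_mul' (by refine hs.congr fun k => ?_; ring)]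
  simp only [pow_zero, mul_one]
  congr 1
  exact tprod_congr fun k => by ring

theorem qShiftedInf_ne_zero {q : ℂ} (hq : ‖q‖ < 1) {a : ℂ} (ha : ∀ k : ℕ, a * q ^ k ≠ 1) :
    qShiftedInf a q ≠ 0 := by
  have := tprod_one_add_ne_zero_of_summable (f := fun k : ℕ => -(a * q ^ k))
    (fun k => by rw [← sub_eq_add_neg]; exact sub_ne_zero.2 (ha k).symm)
    (summable_norm_qShifted_factor hq a)
  simpa [qShiftedInf, sub_eq_add_neg] using this

theorem qShiftedInf_zero (q : ℂ) : qShiftedInf 0 q = 1 := by simp [qShiftedInf]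

theorem qShiftedInf_one {q : ℂ} (hq : ‖q‖ < 1) : qShiftedInf 1 q = 0 := by
  rw [qShiftedInf_eq_mul hq]; simp

theorem tendsto_qShiftedInf {q : ℂ} (hq : ‖q‖ < 1) {b : ℕ → ℂ} (hb : Tendsto b atTop (𝓝 0)) :
    Tendsto (fun M => qShiftedInf (b M) q) atTop (𝓝 1) := by
  have h := tendsto_tprod_one_add_of_dominated_convergence (𝓕 := atTop)
    (f := fun M k => -(b M * q ^ k)) (g := fun _ : ℕ => (0 : ℂ)) (bound := fun k : ℕ => ‖q‖ ^ k)
    (summable_geometric_of_lt_one (norm_nonneg q) hq)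
    (fun k => by simpa using (hb.mul_const (q ^ k)).neg)
    (by
      have : ∀ᶠ M in atTop, ‖b M‖ < 1 := by
        have := hb.norm; rw [norm_zero] at this
        exact this.eventually_lt_const one_pos
      filter_upwards [this] with M hM k
      rw [norm_neg, norm_mul, norm_pow]
      exact mul_le_of_le_one_left (by positivity) hM.le)
  simpa [qShiftedInf, sub_eq_add_neg] using h

/-- Partial products of a convergent nonnegative sequence are `O(r ^ n)` for `r` above the limit. -/
theorem exists_prod_range_le {c : ℕ → ℝ} {l r : ℝ} (hc : ∀ k, 0 ≤ c k)
    (hl : Tendsto c atTop (𝓝 l)) (hlr : l < r) (hr : 0 < r) :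
    ∃ C, 0 ≤ C ∧ ∀ n, ∏ k ∈ range n, c k ≤ C * r ^ n := by
  obtain ⟨N, hN⟩ := eventually_atTop.1 (hl.eventually_le_const hlr)
  have key : ∀ n, ∏ k ∈ range n, c k ≤ (∏ k ∈ range N, (c k + r)) * r⁻¹ ^ N * r ^ n := by
    intro n
    have h1 : ∀ n, n ≤ N → ∏ k ∈ range n, c k ≤ (∏ k ∈ range N, (c k + r)) * r⁻¹ ^ N * r ^ n := by
      intro n hn
      obtain ⟨m, rfl⟩ := Nat.exists_eq_add_of_le hn
      rw [prod_range_add]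
      have e1 : ∏ k ∈ range n, c k ≤ ∏ k ∈ range n, (c k + r) :=
        prod_le_prod (fun k _ => hc k) fun k _ => by linarith
      have e2 : r ^ m ≤ ∏ k ∈ range m, (c (n + k) + r) := by
        calc r ^ m = ∏ _k ∈ range m, r := by simp
          _ ≤ _ := prod_le_prod (fun _ _ => hr.le) fun k _ => by linarith [hc (n + k)]
      calc ∏ k ∈ range n, c k = (∏ k ∈ range n, c k) * r ^ m * r⁻¹ ^ (n + m) * r ^ n := by
            rw [pow_add, inv_pow, inv_pow]; field_simp
        _ ≤ _ := by
            have := prod_nonneg (s := range n) fun k _ => hc k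
            gcongr
            exact this.trans e1
    rcases le_total n N with hn | hn
    · exact h1 n hn
    · induction n, hn using Nat.le_induction with
      | base => exact h1 N le_rfl
      | succ n hn ih =>
        rw [prod_range_succ, pow_succ, ← mul_assoc]
        exact mul_le_mul ih (hN n hn) (hc n)
          ((prod_nonneg fun k _ => hc k).trans ih)
  refine ⟨_, ?_, key⟩
  have := prod_nonneg (s := range N) fun k _ => add_nonneg (hc k) hr.le
  positivity

/-! ### Well-poised factors and their recurrences -/

/-- The factor `x ^ n (1 / x; q)_n / (a q x; q)_n` of a well-poised series, for `n ≥ 0`. -/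
noncomputable def wellPoisedNat (q a x : ℂ) (n : ℕ) : ℂ :=
  ∏ k ∈ range n, (x - q ^ k) / (1 - a * x * q ^ (k + 1))

/-- The factor `x ^ n (1 / x; q)_n / (a q x; q)_n` of a well-poised series, for an integer `n`. -/
noncomputable def wellPoisedFactor (q a x : ℂ) : ℤ → ℂ
  | Int.ofNat n => wellPoisedNat q a x n
  | Int.negSucc m => q ^ (m + 1) * wellPoisedNat q a⁻¹ (a * x) (m + 1)

/-- No denominator of `wellPoisedFactor q a x` vanishes. -/
def WellPoisedRegular (q a x : ℂ) : Prop :=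
  ∀ k : ℕ, x * q ^ (k + 1) ≠ 1 ∧ a * x * q ^ (k + 1) ≠ 1

namespace WellPoisedRegular

variable {q a x : ℂ}

theorem den_ne_zero (h : WellPoisedRegular q a x) (k : ℕ) : 1 - a * x * q ^ (k + 1) ≠ 0 :=
  sub_ne_zero.2 (h k).2.symm

theorem one_sub_ne_zero (h : WellPoisedRegular q a x) (k : ℕ) : 1 - x * q ^ (k + 1) ≠ 0 :=
  sub_ne_zero.2 (h k).1.symm

theorem shift (h : WellPoisedRegular q a x) : WellPoisedRegular q a (q * x) := fun k =>
  ⟨by convert (h (k + 1)).1 using 1; ring, by convert (h (k + 1)).2 using 1; ring⟩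

theorem reflect (ha : a ≠ 0) (h : WellPoisedRegular q a x) :
    WellPoisedRegular q a⁻¹ (a * x) := fun k =>
  ⟨(h k).2, by rw [inv_mul_cancel_left₀ ha]; exact (h k).1⟩

theorem pow_shift (h : WellPoisedRegular q a x) (M : ℕ) :
    WellPoisedRegular q a (q ^ M * x) := by
  induction M with
  | zero => simpa using h
  | succ M ih => rw [pow_succ', mul_assoc]; exact ih.shift

theorem zero (q a : ℂ) : WellPoisedRegular q a 0 := fun k => by simp

end WellPoisedRegular

theorem wellPoisedFactor_natCast (q a x : ℂ) (n : ℕ) :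
    wellPoisedFactor q a x n = wellPoisedNat q a x n := rfl

/-- Reversing the index exchanges (a, x) with (a⁻¹, ax), up to a power of q. This symmetry reduces
negative indices to natural ones throughout. -/
theorem wellPoisedFactor_neg (q a x : ℂ) (n : ℕ) :
    wellPoisedFactor q a x (-(n : ℤ)) = q ^ n * wellPoisedNat q a⁻¹ (a * x) n := by
  cases n with
  | zero =>
    change wellPoisedNat q a x 0 = _
    simp [wellPoisedNat]
  | succ n => rfl

theorem wellPoisedNat_succ {q a x : ℂ} (h : WellPoisedRegular q a x) (n : ℕ) :
    wellPoisedNat q a x (n + 1) * (1 - a * x * q ^ (n + 1)) =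
      wellPoisedNat q a x n * (x - q ^ n) := by
  rw [wellPoisedNat, prod_range_succ, mul_assoc, div_mul_cancel₀ _ (h.den_ne_zero n)]; rfl

/-- Since qx - q^(k+1) = q(x - q^k), the products for x and qx have the same factors moved by one
place, and only the boundary factors differ. -/
theorem wellPoisedNat_shift {q a x : ℂ} (h : WellPoisedRegular q a x) (n : ℕ) :
    wellPoisedNat q a x n * (q ^ n * (q * x - 1) * (1 - a * (q * x))) =
      wellPoisedNat q a (q * x) n * ((q * x - q ^ n) * (1 - a * (q * x) * q ^ n)) := by
  induction n with
  | zero => simp [wellPoisedNat]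
  | succ n ih =>
    have e1 := wellPoisedNat_succ h n
    have e2 := wellPoisedNat_succ h.shift n
    have h0 := h.den_ne_zero n
    refine mul_left_cancel₀ h0 ?_
    linear_combination (q ^ (n + 1) * (q * x - 1) * (1 - a * (q * x))) * e1
      + q * (x - q ^ n) * ih - (1 - a * x * q ^ (n + 1)) * (q * x - q ^ (n + 1)) * e2

theorem wellPoisedFactor_succ {q a x : ℂ} (hq : q ≠ 0) (ha : a ≠ 0)
    (h : WellPoisedRegular q a x) (n : ℤ) :
    wellPoisedFactor q a x (n + 1) * (1 - a * x * (q * q ^ n)) =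
      wellPoisedFactor q a x n * (x - q ^ n) := by
  cases n with
  | ofNat m =>
    have e := wellPoisedNat_succ h m
    rw [pow_succ'] at e
    simpa [← wellPoisedFactor_natCast] using e
  | negSucc m =>
    have e := wellPoisedNat_succ (h.reflect ha) m
    rw [inv_mul_cancel_left₀ ha] at e
    rw [show Int.negSucc m + 1 = -(m : ℤ) by rw [Int.negSucc_eq]; ring,
      show Int.negSucc m = -((m + 1 : ℕ) : ℤ) from rfl, wellPoisedFactor_neg,
      wellPoisedFactor_neg, zpow_neg, zpow_natCast]
    have hm : q ^ m ≠ 0 := pow_ne_zero _ hq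
    generalize wellPoisedNat q a⁻¹ (a * x) m = u at *
    generalize wellPoisedNat q a⁻¹ (a * x) (m + 1) = v at *
    rw [pow_succ'] at e ⊢
    field_simp
    linear_combination e

theorem wellPoisedFactor_shift {q a x : ℂ} (hq : q ≠ 0) (ha : a ≠ 0)
    (h : WellPoisedRegular q a x) (n : ℤ) :
    wellPoisedFactor q a x n * (q ^ n * (q * x - 1) * (1 - a * (q * x))) =
      wellPoisedFactor q a (q * x) n * ((q * x - q ^ n) * (1 - a * (q * x) * q ^ n)) := by
  obtain ⟨m, rfl | rfl⟩ := n.eq_nat_or_neg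
  · simpa only [wellPoisedFactor_natCast, zpow_natCast] using wellPoisedNat_shift h m
  · have e := wellPoisedNat_shift (h.reflect ha) m
    rw [show q * (a * x) = a * (q * x) by ring, inv_mul_cancel_left₀ ha] at e
    rw [wellPoisedFactor_neg, wellPoisedFactor_neg, zpow_neg, zpow_natCast]
    have hm : q ^ m ≠ 0 := pow_ne_zero _ hq
    generalize wellPoisedNat q a⁻¹ (a * x) m = u at *
    generalize wellPoisedNat q a⁻¹ (a * (q * x)) m = v at *
    field_simp
    linear_combination e

/-! ### Bounds and limits of the well-poised factors -/

theorem norm_wellPoisedNat_le (q a x : ℂ) {r : ℝ} (hq : ‖q‖ < 1) (hr : ‖x‖ < r) :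
    ∃ C, 0 ≤ C ∧ ∀ n, ‖wellPoisedNat q a x n‖ ≤ C * r ^ n := by
  have hqk : Tendsto (fun k : ℕ => q ^ k) atTop (𝓝 0) := tendsto_pow_atTop_nhds_zero_of_norm_lt_one hq
  have hl : Tendsto (fun k : ℕ => ‖(x - q ^ k) / (1 - a * x * q ^ (k + 1))‖) atTop (𝓝 ‖x‖) := by
    have h2 := (tendsto_const_nhds (x := x)).sub hqk |>.div
      ((tendsto_const_nhds (x := (1 : ℂ))).sub
        (((tendsto_add_atTop_iff_nat 1).2 hqk).const_mul (a * x))) (by simp)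
    simpa using h2.norm
  obtain ⟨C, hC, h⟩ := exists_prod_range_le (fun k => norm_nonneg _) hl hr
    ((norm_nonneg x).trans_lt hr)
  exact ⟨C, hC, fun n => by rw [wellPoisedNat, norm_prod]; exact h n⟩

/-- Each factor is majorised by an expression in ε alone, whose limit is ε. One constant then serves
the whole ball, as dominated convergence requires. -/
theorem norm_wellPoisedNat_le_uniform (q a : ℂ) {ε r : ℝ} (hq : ‖q‖ < 1) (hε : 0 ≤ ε)
    (ha : ‖a‖ * ε < 1) (hr : ε < r) :
    ∃ C, 0 ≤ C ∧ ∀ x, ‖x‖ ≤ ε → ∀ n, ‖wellPoisedNat q a x n‖ ≤ C * r ^ n := by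
  have hqk : Tendsto (fun k : ℕ => ‖q‖ ^ k) atTop (𝓝 0) :=
    tendsto_pow_atTop_nhds_zero_of_lt_one (norm_nonneg q) hq
  have hpos : ∀ k : ℕ, 0 < 1 - ‖a‖ * ε * ‖q‖ ^ (k + 1) := fun k => by
    have : ‖a‖ * ε * ‖q‖ ^ (k + 1) ≤ ‖a‖ * ε :=
      mul_le_of_le_one_right (by positivity) (pow_le_one₀ (norm_nonneg q) hq.le)
    linarith
  have hl : Tendsto (fun k : ℕ => (ε + ‖q‖ ^ k) / (1 - ‖a‖ * ε * ‖q‖ ^ (k + 1)))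
      atTop (𝓝 ε) := by
    have h2 := (tendsto_const_nhds (x := ε)).add hqk |>.div
      ((tendsto_const_nhds (x := (1 : ℝ))).sub
        (((tendsto_add_atTop_iff_nat 1).2 hqk).const_mul (‖a‖ * ε))) (by simp)
    simpa [Pi.div_def] using h2
  obtain ⟨C, hC, h⟩ := exists_prod_range_le
    (fun k => div_nonneg (by positivity) (hpos k).le) hl hr (hε.trans_lt hr)
  refine ⟨C, hC, fun x hx n => le_trans ?_ (h n)⟩
  rw [wellPoisedNat, norm_prod]
  refine prod_le_prod (fun _ _ => norm_nonneg _) fun k _ => ?_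
  rw [norm_div]
  have h1 : ‖x - q ^ k‖ ≤ ε + ‖q‖ ^ k :=
    (norm_sub_le _ _).trans (by rw [norm_pow]; gcongr)
  have h2 : 1 - ‖a‖ * ε * ‖q‖ ^ (k + 1) ≤ ‖1 - a * x * q ^ (k + 1)‖ := by
    have := norm_sub_norm_le (1 : ℂ) (a * x * q ^ (k + 1))
    rw [norm_one, norm_mul, norm_mul, norm_pow] at this
    have h3 : ‖a‖ * ‖x‖ * ‖q‖ ^ (k + 1) ≤ ‖a‖ * ε * ‖q‖ ^ (k + 1) := by gcongr
    linarith
  exact div_le_div₀ (by positivity) h1 (hpos k) h2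

theorem tendsto_wellPoisedNat {q a : ℂ} {x : ℕ → ℂ} (hx : Tendsto x atTop (𝓝 0)) (n : ℕ) :
    Tendsto (fun M => wellPoisedNat q a (x M) n) atTop (𝓝 (wellPoisedNat q a 0 n)) := by
  refine tendsto_finsetProd _ fun k _ => ?_
  refine (hx.sub_const _).div (((hx.const_mul a).mul_const _).const_sub 1) (by simp)

theorem tendsto_wellPoisedFactor {q a : ℂ} {x : ℕ → ℂ} (hx : Tendsto x atTop (𝓝 0)) (n : ℤ) :
    Tendsto (fun M => wellPoisedFactor q a (x M) n) atTop (𝓝 (wellPoisedFactor q a 0 n)) := by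
  cases n with
  | ofNat n => exact tendsto_wellPoisedNat hx n
  | negSucc n =>
    have : Tendsto (fun M => a * x M) atTop (𝓝 0) := by simpa using hx.const_mul a
    simpa [wellPoisedFactor] using (tendsto_wellPoisedNat this (n + 1)).const_mul (q ^ (n + 1))

/-! ### The very-well-poised summand and its telescoping relation -/

/-- The well-poised product `(a² q) ^ n ∏ⱼ xⱼ ^ n (1 / xⱼ; q)_n / (a q xⱼ; q)_n`. -/
noncomputable def wellPoisedProd (q a x y z w : ℂ) (n : ℤ) : ℂ :=
  (a ^ 2 * q) ^ n * (wellPoisedFactor q a x n * wellPoisedFactor q a y n *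
    wellPoisedFactor q a z n * wellPoisedFactor q a w n)

/-- The term of the very-well-poised bilateral series with parameters `1 / x, …, 1 / w`,
multiplied by `1 - a`. -/
noncomputable def veryWellPoisedTerm (q a x y z w : ℂ) (n : ℤ) : ℂ :=
  (1 - a * (q ^ n) ^ 2) * wellPoisedProd q a x y z w n

/-- The certificate whose differences give the contiguous relation. -/
noncomputable def wellPoisedCert (q a x y z w : ℂ) (n : ℤ) : ℂ :=
  (q ^ n)⁻¹ * ((1 - a * x * q ^ n) * (1 - a * y * q ^ n) * (1 - a * z * q ^ n) *
    (1 - a * w * q ^ n)) * wellPoisedProd q a x y z w n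

/-- The four reciprocal parameters are regular. -/
def WellPoisedRegular₄ (q a x y z w : ℂ) : Prop :=
  WellPoisedRegular q a x ∧ WellPoisedRegular q a y ∧ WellPoisedRegular q a z ∧
    WellPoisedRegular q a w

/-- The four linear factors of the certificate at n + 1 are exactly the denominators gained in
passing from n to n + 1, so both ends of the difference are multiples of the same product at n. -/
theorem wellPoisedCert_succ {q a x y z w : ℂ} (hq : q ≠ 0) (ha : a ≠ 0)
    (h : WellPoisedRegular₄ q a x y z w) (n : ℤ) :
    wellPoisedCert q a x y z w (n + 1) =
      (q ^ n)⁻¹ * a ^ 2 * ((x - q ^ n) * (y - q ^ n) * (z - q ^ n) * (w - q ^ n)) *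
        wellPoisedProd q a x y z w n := by
  have ex := wellPoisedFactor_succ hq ha h.1 n
  have ey := wellPoisedFactor_succ hq ha h.2.1 n
  have ez := wellPoisedFactor_succ hq ha h.2.2.1 n
  have ew := wellPoisedFactor_succ hq ha h.2.2.2 n
  unfold wellPoisedCert wellPoisedProd
  have haq : a ^ 2 * q ≠ 0 := by positivity
  rw [zpow_add_one₀ hq, zpow_add_one₀ haq, mul_comm (q ^ n) q]
  have hQ : q ^ n ≠ 0 := zpow_ne_zero _ hq
  generalize (a ^ 2 * q) ^ n = R at *
  generalize q ^ n = Q at *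
  calc _ = (q * Q)⁻¹ * R * (a ^ 2 * q) *
        ((wellPoisedFactor q a x (n + 1) * (1 - a * x * (q * Q))) *
          (wellPoisedFactor q a y (n + 1) * (1 - a * y * (q * Q))) *
          (wellPoisedFactor q a z (n + 1) * (1 - a * z * (q * Q))) *
          (wellPoisedFactor q a w (n + 1) * (1 - a * w * (q * Q)))) := by ring
    _ = _ := by rw [ex, ey, ez, ew]; field_simp

/-- Every term is a multiple of the well-poised product at (qx, y, z, w). Once that product is taken
out, a rational identity in q^n and the parameters remains. -/
theorem veryWellPoisedTerm_contiguous {q a x y z w : ℂ} (hq : q ≠ 0) (ha : a ≠ 0)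
    (h : WellPoisedRegular₄ q a x y z w) (n : ℤ) :
    (1 - a * (q * x)) * (1 - q * x) * (1 - a ^ 2 * (q * x) * y * z * w) *
        veryWellPoisedTerm q a x y z w n -
      (1 - a * (q * x) * y) * (1 - a * (q * x) * z) * (1 - a * (q * x) * w) *
        veryWellPoisedTerm q a (q * x) y z w n =
      q * x * (wellPoisedCert q a (q * x) y z w (n + 1) - wellPoisedCert q a (q * x) y z w n) := by
  have es := wellPoisedFactor_shift hq ha h.1 n
  rw [wellPoisedCert_succ hq ha ⟨h.1.shift, h.2⟩]
  unfold veryWellPoisedTerm wellPoisedCert wellPoisedProd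
  have hQ : q ^ n ≠ 0 := zpow_ne_zero _ hq
  -- The prefactor (1 - aqx)(1 - qx) is what allows the factor at x to be expressed through the
  -- factor at qx.
  have e : (1 - a * (q * x)) * (1 - q * x) * wellPoisedFactor q a x n =
      -(q ^ n)⁻¹ * (wellPoisedFactor q a (q * x) n *
        ((q * x - q ^ n) * (1 - a * (q * x) * q ^ n))) := by
    rw [← es]; field_simp; ring
  generalize (a ^ 2 * q) ^ n = R at *
  generalize q ^ n = Q at *
  generalize wellPoisedFactor q a x n = P at *
  generalize wellPoisedFactor q a y n = Py at *
  generalize wellPoisedFactor q a z n = Pz at *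
  generalize wellPoisedFactor q a w n = Pw at *
  generalize wellPoisedFactor q a (q * x) n = P' at *
  generalize q * x = v at *
  calc _ = (1 - a ^ 2 * v * y * z * w) * (1 - a * Q ^ 2) * R * Py * Pz * Pw *
        ((1 - a * v) * (1 - v) * P) - (1 - a * v * y) * (1 - a * v * z) * (1 - a * v * w) *
        ((1 - a * Q ^ 2) * (R * (P' * Py * Pz * Pw))) := by ring
    _ = _ := by rw [e]; field_simp; ring

/-! ### Absolute convergence in both directions -/

theorem summable_wellPoisedNat {q a x y z w c : ℂ} (hq : ‖q‖ < 1)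
    (h : ‖c * (x * y * z * w)‖ < 1) {g : ℕ → ℂ} {B : ℝ} (hg : ∀ n, ‖g n‖ ≤ B) :
    Summable fun n : ℕ => g n * (c ^ n * (wellPoisedNat q a x n * wellPoisedNat q a y n *
      wellPoisedNat q a z n * wellPoisedNat q a w n)) := by
  -- The growth bounds hold only for rates strictly above the norms, so each norm is enlarged by a δ
  -- that keeps the total ratio below 1.
  have hcont : Tendsto (fun δ : ℝ => ‖c‖ * ((‖x‖ + δ) * (‖y‖ + δ) * (‖z‖ + δ) * (‖w‖ + δ)))
      (𝓝[>] 0) (𝓝 (‖c‖ * ((‖x‖ + 0) * (‖y‖ + 0) * (‖z‖ + 0) * (‖w‖ + 0)))) :=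
    Tendsto.mono_left (Continuous.tendsto (by fun_prop) 0) nhdsWithin_le_nhds
  have hlt : ‖c‖ * ((‖x‖ + 0) * (‖y‖ + 0) * (‖z‖ + 0) * (‖w‖ + 0)) < 1 := by
    simpa [norm_mul] using h
  obtain ⟨δ, hδ1, hδ⟩ := ((hcont.eventually_lt_const hlt).and self_mem_nhdsWithin).exists
  have hδ : 0 < δ := hδ
  obtain ⟨Cx, hCx, hx⟩ := norm_wellPoisedNat_le q a x hq (lt_add_of_pos_right ‖x‖ hδ)
  obtain ⟨Cy, hCy, hy⟩ := norm_wellPoisedNat_le q a y hq (lt_add_of_pos_right ‖y‖ hδ)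
  obtain ⟨Cz, hCz, hz⟩ := norm_wellPoisedNat_le q a z hq (lt_add_of_pos_right ‖z‖ hδ)
  obtain ⟨Cw, hCw, hw⟩ := norm_wellPoisedNat_le q a w hq (lt_add_of_pos_right ‖w‖ hδ)
  have hB : 0 ≤ B := (norm_nonneg _).trans (hg 0)
  refine Summable.of_norm_bounded ((summable_geometric_of_lt_one (by positivity) hδ1).mul_left
    (B * (Cx * Cy * Cz * Cw))) fun n => ?_
  rw [norm_mul, norm_mul, norm_mul, norm_mul, norm_mul, norm_pow]
  calc _ ≤ B * (‖c‖ ^ n * ((Cx * (‖x‖ + δ) ^ n) * (Cy * (‖y‖ + δ) ^ n) *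
        (Cz * (‖z‖ + δ) ^ n) * (Cw * (‖w‖ + δ) ^ n))) := by
        gcongr
        exacts [hg n, hx n, hy n, hz n, hw n]
    _ = _ := by simp only [mul_pow]; ring

theorem wellPoisedProd_neg {q a : ℂ} (hq : q ≠ 0) (ha : a ≠ 0) (x y z w : ℂ) (n : ℕ) :
    wellPoisedProd q a x y z w (-(n : ℤ)) = (q ^ n) ^ 2 *
      wellPoisedProd q a⁻¹ (a * x) (a * y) (a * z) (a * w) n := by
  simp only [wellPoisedProd, wellPoisedFactor_neg, wellPoisedFactor_natCast, zpow_neg,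
    zpow_natCast]
  rw [mul_pow, mul_pow, inv_pow, inv_pow]
  have hqn : q ^ n ≠ 0 := pow_ne_zero _ hq
  have han : (a ^ 2) ^ n ≠ 0 := pow_ne_zero _ (pow_ne_zero _ ha)
  generalize wellPoisedNat q a⁻¹ (a * x) n = X
  generalize wellPoisedNat q a⁻¹ (a * y) n = Y
  generalize wellPoisedNat q a⁻¹ (a * z) n = Z
  generalize wellPoisedNat q a⁻¹ (a * w) n = W
  generalize (a ^ 2) ^ n = A at *
  field_simp

/-- The factor q^(2n) from the reflected product turns 1 - aq^(-2n) into -a(1 - a⁻¹q^(2n)). As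
a²xyzw is invariant under the reflection, both tails converge under the same condition. -/
theorem veryWellPoisedTerm_neg {q a : ℂ} (hq : q ≠ 0) (ha : a ≠ 0) (x y z w : ℂ) (n : ℕ) :
    veryWellPoisedTerm q a x y z w (-(n : ℤ)) = -a *
      veryWellPoisedTerm q a⁻¹ (a * x) (a * y) (a * z) (a * w) n := by
  simp only [veryWellPoisedTerm, wellPoisedProd_neg hq ha, zpow_neg, zpow_natCast]
  generalize wellPoisedProd q a⁻¹ (a * x) (a * y) (a * z) (a * w) n = U
  have hqn : q ^ n ≠ 0 := pow_ne_zero _ hq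
  field_simp
  ring

theorem norm_one_sub_mul_pow_le {q : ℂ} (hq : ‖q‖ < 1) (b : ℂ) (n : ℕ) :
    ‖1 - b * q ^ n‖ ≤ 1 + ‖b‖ := by
  refine (norm_sub_le _ _).trans ?_
  rw [norm_one, norm_mul, norm_pow]
  have := mul_le_of_le_one_right (norm_nonneg b) (pow_le_one₀ (n := n) (norm_nonneg q) hq.le)
  linarith

theorem norm_pow_sub_le {q : ℂ} (hq : ‖q‖ < 1) (b : ℂ) (n : ℕ) :
    ‖q ^ n - b‖ ≤ 1 + ‖b‖ := by
  refine (norm_sub_le _ _).trans ?_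
  rw [norm_pow]
  have := pow_le_one₀ (n := n) (norm_nonneg q) hq.le
  linarith

theorem summable_veryWellPoisedTerm_nat {q a x y z w : ℂ} (hq : ‖q‖ < 1)
    (h : ‖a ^ 2 * q * (x * y * z * w)‖ < 1) :
    Summable fun n : ℕ => veryWellPoisedTerm q a x y z w n := by
  refine (summable_wellPoisedNat (a := a) (g := fun n => 1 - a * (q ^ n) ^ 2) (B := 1 + ‖a‖)
    hq h fun n => ?_).congr fun n => ?_
  · rw [← pow_mul]; exact norm_one_sub_mul_pow_le hq a _
  · simp [veryWellPoisedTerm, wellPoisedProd, wellPoisedFactor_natCast]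

theorem summable_veryWellPoisedTerm {q a x y z w : ℂ} (hq0 : q ≠ 0) (hq : ‖q‖ < 1) (ha : a ≠ 0)
    (h : ‖a ^ 2 * q * (x * y * z * w)‖ < 1) :
    Summable (veryWellPoisedTerm q a x y z w) := by
  refine Summable.of_nat_of_neg (summable_veryWellPoisedTerm_nat hq h) ?_
  simp only [veryWellPoisedTerm_neg hq0 ha]
  refine (summable_veryWellPoisedTerm_nat hq ?_).mul_left _
  convert h using 2
  field_simp

/-- The factor (q^n)⁻¹ removes a q from the ratio of the forward tail. The resulting condition,
taken at qx, is the convergence condition of the series at x. -/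
theorem summable_wellPoisedCert {q a x y z w : ℂ} (hq0 : q ≠ 0) (hq : ‖q‖ < 1) (ha : a ≠ 0)
    (h : ‖a ^ 2 * (x * y * z * w)‖ < 1) :
    Summable (wellPoisedCert q a x y z w) := by
  refine Summable.of_nat_of_neg ?_ ?_
  · refine (summable_wellPoisedNat (a := a) (g := fun n => (1 - a * x * q ^ n) *
      (1 - a * y * q ^ n) * (1 - a * z * q ^ n) * (1 - a * w * q ^ n))
      (B := (1 + ‖a * x‖) * (1 + ‖a * y‖) * (1 + ‖a * z‖) * (1 + ‖a * w‖))
      hq h fun n => ?_).congr fun n => ?_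
    · rw [norm_mul _ (1 - a * w * q ^ n), norm_mul _ (1 - a * z * q ^ n),
        norm_mul _ (1 - a * y * q ^ n)]
      gcongr <;> exact norm_one_sub_mul_pow_le hq _ _
    · have hqn : q ^ n ≠ 0 := pow_ne_zero _ hq0
      simp only [wellPoisedCert, wellPoisedProd, wellPoisedFactor_natCast, zpow_natCast, mul_pow]
      field_simp
  · have h' : ‖(a⁻¹ ^ 2) * ((a * x) * (a * y) * (a * z) * (a * w))‖ < 1 := by
      convert h using 2
      field_simp
    refine (summable_wellPoisedNat (a := a⁻¹) (g := fun n => (q ^ n - a * x) *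
      (q ^ n - a * y) * (q ^ n - a * z) * (q ^ n - a * w))
      (B := (1 + ‖a * x‖) * (1 + ‖a * y‖) * (1 + ‖a * z‖) * (1 + ‖a * w‖))
      hq h' fun n => ?_).congr fun n => ?_
    · rw [norm_mul _ (q ^ n - a * w), norm_mul _ (q ^ n - a * z),
        norm_mul _ (q ^ n - a * y)]
      gcongr <;> exact norm_pow_sub_le hq _ _
    · have hqn : q ^ n ≠ 0 := pow_ne_zero _ hq0
      simp only [wellPoisedCert, wellPoisedProd_neg hq0 ha, zpow_neg, zpow_natCast]
      simp only [wellPoisedProd, wellPoisedFactor_natCast, zpow_natCast, mul_pow]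
      generalize wellPoisedNat q a⁻¹ (a * x) n = X
      generalize wellPoisedNat q a⁻¹ (a * y) n = Y
      generalize wellPoisedNat q a⁻¹ (a * z) n = Z
      generalize wellPoisedNat q a⁻¹ (a * w) n = W
      generalize (a⁻¹ ^ 2) ^ n = A at *
      field_simp

/-! ### The sum, its product side, and q-shifts of the variables -/

/-- The very-well-poised bilateral sum with parameters `1 / x, …, 1 / w`, multiplied by `1 - a`. -/
noncomputable def veryWellPoisedSum (q a x y z w : ℂ) : ℂ :=
  ∑' n : ℤ, veryWellPoisedTerm q a x y z w n

/-- The parameter-dependent denominator in the evaluation of `veryWellPoisedSum`. -/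
noncomputable def wellPoisedDenom (q a x y z w : ℂ) : ℂ :=
  qShiftedInf (a * q * x) q * qShiftedInf (a * q * y) q * qShiftedInf (a * q * z) q *
    qShiftedInf (a * q * w) q * (qShiftedInf (q * x) q * qShiftedInf (q * y) q *
    qShiftedInf (q * z) q * qShiftedInf (q * w) q) * qShiftedInf (a ^ 2 * q * (x * y * z * w)) q

/-- The parameter-dependent numerator in the evaluation of `veryWellPoisedSum`. -/
noncomputable def wellPoisedNumer (q a x y z w : ℂ) : ℂ :=
  qShiftedInf (a * q * (x * y)) q * qShiftedInf (a * q * (x * z)) q *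
    qShiftedInf (a * q * (x * w)) q * qShiftedInf (a * q * (y * z)) q *
    qShiftedInf (a * q * (y * w)) q * qShiftedInf (a * q * (z * w)) q

theorem veryWellPoisedSum_contiguous {q a x y z w : ℂ} (hq0 : q ≠ 0) (hq : ‖q‖ < 1) (ha : a ≠ 0)
    (hr : WellPoisedRegular₄ q a x y z w) (h : ‖a ^ 2 * q * (x * y * z * w)‖ < 1) :
    (1 - a * (q * x)) * (1 - q * x) * (1 - a ^ 2 * (q * x) * y * z * w) *
        veryWellPoisedSum q a x y z w =
      (1 - a * (q * x) * y) * (1 - a * (q * x) * z) * (1 - a * (q * x) * w) *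
        veryWellPoisedSum q a (q * x) y z w := by
  have hG : Summable (wellPoisedCert q a (q * x) y z w) :=
    summable_wellPoisedCert hq0 hq ha (by convert h using 2; ring)
  have h' : ‖a ^ 2 * q * (q * x * y * z * w)‖ < 1 := by
    rw [show a ^ 2 * q * (q * x * y * z * w) = q * (a ^ 2 * q * (x * y * z * w)) by ring,
      norm_mul]
    nlinarith [norm_nonneg q, norm_nonneg (a ^ 2 * q * (x * y * z * w))]
  have hs := summable_veryWellPoisedTerm hq0 hq ha h
  have hs' := summable_veryWellPoisedTerm hq0 hq ha h'
  have hG1 : Summable fun n : ℤ => wellPoisedCert q a (q * x) y z w (n + 1) :=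
    (Equiv.addRight (1 : ℤ)).summable_iff.2 hG
  -- Translation invariance of the sum over ℤ makes the telescoping side vanish, with no boundary
  -- terms.
  have e1 : ∑' n : ℤ, wellPoisedCert q a (q * x) y z w (n + 1) =
      ∑' n : ℤ, wellPoisedCert q a (q * x) y z w n :=
    (Equiv.addRight (1 : ℤ)).tsum_eq (wellPoisedCert q a (q * x) y z w)
  unfold veryWellPoisedSum
  rw [← sub_eq_zero, ← tsum_mul_left, ← tsum_mul_left,
    ← (hs.mul_left _).tsum_sub (hs'.mul_left _)]
  simp only [veryWellPoisedTerm_contiguous hq0 ha hr]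
  rw [tsum_mul_left, hG1.tsum_sub hG, e1, sub_self, mul_zero]

theorem veryWellPoisedSum_rotate (q a x y z w : ℂ) :
    veryWellPoisedSum q a y z w x = veryWellPoisedSum q a x y z w :=
  tsum_congr fun n => by simp only [veryWellPoisedTerm, wellPoisedProd]; ring

theorem wellPoisedDenom_rotate (q a x y z w : ℂ) :
    wellPoisedDenom q a y z w x = wellPoisedDenom q a x y z w := by
  simp only [wellPoisedDenom]
  rw [show y * z * w * x = x * y * z * w by ring]; ring

theorem wellPoisedNumer_rotate (q a x y z w : ℂ) :
    wellPoisedNumer q a y z w x = wellPoisedNumer q a x y z w := by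
  simp only [wellPoisedNumer]
  rw [mul_comm y x, mul_comm z x, mul_comm w x]; ring

theorem wellPoisedDenom_shift {q : ℂ} (hq : ‖q‖ < 1) (a x y z w : ℂ) :
    wellPoisedDenom q a x y z w = (1 - a * (q * x)) * (1 - q * x) *
      (1 - a ^ 2 * (q * x) * y * z * w) * wellPoisedDenom q a (q * x) y z w := by
  unfold wellPoisedDenom
  rw [qShiftedInf_eq_mul hq (a * q * x), qShiftedInf_eq_mul hq (q * x),
    qShiftedInf_eq_mul hq (a ^ 2 * q * (x * y * z * w)),
    show q * (a * q * x) = a * q * (q * x) by ring,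
    show q * (a ^ 2 * q * (x * y * z * w)) = a ^ 2 * q * (q * x * y * z * w) by ring]
  ring

theorem wellPoisedNumer_shift {q : ℂ} (hq : ‖q‖ < 1) (a x y z w : ℂ) :
    wellPoisedNumer q a x y z w = (1 - a * (q * x) * y) * (1 - a * (q * x) * z) *
      (1 - a * (q * x) * w) * wellPoisedNumer q a (q * x) y z w := by
  unfold wellPoisedNumer
  rw [qShiftedInf_eq_mul hq (a * q * (x * y)), qShiftedInf_eq_mul hq (a * q * (x * z)),
    qShiftedInf_eq_mul hq (a * q * (x * w)),
    show q * (a * q * (x * y)) = a * q * (q * x * y) by ring,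
    show q * (a * q * (x * z)) = a * q * (q * x * z) by ring,
    show q * (a * q * (x * w)) = a * q * (q * x * w) by ring]
  ring

/-- Shifting the first parameter and rotating multiplies `S D` and `N` by the same factor. -/
theorem exists_factor_shift_rotate {q a x y z w : ℂ} (hq0 : q ≠ 0) (hq : ‖q‖ < 1) (ha : a ≠ 0)
    (hr : WellPoisedRegular₄ q a x y z w) (h : ‖a ^ 2 * q * (x * y * z * w)‖ < 1) :
    ∃ C, veryWellPoisedSum q a x y z w * wellPoisedDenom q a x y z w =
        C * (veryWellPoisedSum q a y z w (q * x) * wellPoisedDenom q a y z w (q * x)) ∧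
      wellPoisedNumer q a x y z w = C * wellPoisedNumer q a y z w (q * x) := by
  refine ⟨(1 - a * (q * x) * y) * (1 - a * (q * x) * z) * (1 - a * (q * x) * w), ?_, ?_⟩
  · rw [veryWellPoisedSum_rotate q a (q * x), wellPoisedDenom_rotate q a (q * x),
      wellPoisedDenom_shift hq a x]
    linear_combination wellPoisedDenom q a (q * x) y z w *
      veryWellPoisedSum_contiguous hq0 hq ha hr h
  · rw [wellPoisedNumer_rotate q a (q * x), wellPoisedNumer_shift hq a x]

theorem norm_shift_lt {q c x y z w : ℂ} (hq : ‖q‖ < 1) (h : ‖c * (x * y * z * w)‖ < 1) :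
    ‖c * (y * z * w * (q * x))‖ < 1 := by
  rw [show c * (y * z * w * (q * x)) = q * (c * (x * y * z * w)) by ring, norm_mul]
  nlinarith [norm_nonneg q, norm_nonneg (c * (x * y * z * w))]

/-- Four rounds of shifting and rotating restore the order of the variables, each now multiplied by
q. Only the equality of the two factors matters, so C stays existential and may vanish. -/
theorem exists_factor_shift_all {q a x y z w : ℂ} (hq0 : q ≠ 0) (hq : ‖q‖ < 1) (ha : a ≠ 0)
    (hr : WellPoisedRegular₄ q a x y z w) (h : ‖a ^ 2 * q * (x * y * z * w)‖ < 1) :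
    ‖a ^ 2 * q * (q * x * (q * y) * (q * z) * (q * w))‖ < 1 ∧
    ∃ C, veryWellPoisedSum q a x y z w * wellPoisedDenom q a x y z w =
        C * (veryWellPoisedSum q a (q * x) (q * y) (q * z) (q * w) *
          wellPoisedDenom q a (q * x) (q * y) (q * z) (q * w)) ∧
      wellPoisedNumer q a x y z w =
        C * wellPoisedNumer q a (q * x) (q * y) (q * z) (q * w) := by
  obtain ⟨hx, hy, hz, hw⟩ := hr
  have h1 := norm_shift_lt hq h
  have h2 := norm_shift_lt hq h1
  have h3 := norm_shift_lt hq h2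
  obtain ⟨C1, e1, f1⟩ := exists_factor_shift_rotate hq0 hq ha ⟨hx, hy, hz, hw⟩ h
  obtain ⟨C2, e2, f2⟩ := exists_factor_shift_rotate hq0 hq ha ⟨hy, hz, hw, hx.shift⟩ h1
  obtain ⟨C3, e3, f3⟩ := exists_factor_shift_rotate hq0 hq ha ⟨hz, hw, hx.shift, hy.shift⟩ h2
  obtain ⟨C4, e4, f4⟩ :=
    exists_factor_shift_rotate hq0 hq ha ⟨hw, hx.shift, hy.shift, hz.shift⟩ h3
  refine ⟨norm_shift_lt hq h3, C1 * C2 * C3 * C4, ?_, ?_⟩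
  · rw [e1, e2, e3, e4]; ring
  · rw [f1, f2, f3, f4]; ring

theorem exists_factor_shift_pow {q a x y z w : ℂ} (hq0 : q ≠ 0) (hq : ‖q‖ < 1) (ha : a ≠ 0)
    (hr : WellPoisedRegular₄ q a x y z w) (h : ‖a ^ 2 * q * (x * y * z * w)‖ < 1) (M : ℕ) :
    ‖a ^ 2 * q * (q ^ M * x * (q ^ M * y) * (q ^ M * z) * (q ^ M * w))‖ < 1 ∧
    ∃ C, veryWellPoisedSum q a x y z w * wellPoisedDenom q a x y z w =
        C * (veryWellPoisedSum q a (q ^ M * x) (q ^ M * y) (q ^ M * z) (q ^ M * w) *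
          wellPoisedDenom q a (q ^ M * x) (q ^ M * y) (q ^ M * z) (q ^ M * w)) ∧
      wellPoisedNumer q a x y z w =
        C * wellPoisedNumer q a (q ^ M * x) (q ^ M * y) (q ^ M * z) (q ^ M * w) := by
  induction M with
  | zero =>
    simp only [pow_zero, one_mul]
    exact ⟨h, 1, (one_mul _).symm, (one_mul _).symm⟩
  | succ M ih =>
    obtain ⟨h1, C, e, f⟩ := ih
    obtain ⟨h2, C', e', f'⟩ := exists_factor_shift_all hq0 hq ha
      ⟨hr.1.pow_shift M, hr.2.1.pow_shift M, hr.2.2.1.pow_shift M, hr.2.2.2.pow_shift M⟩ h1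
    have hM : ∀ u, q ^ (M + 1) * u = q * (q ^ M * u) := fun u => by ring
    simp only [hM]
    refine ⟨h2, C * C', ?_, ?_⟩
    · rw [e, e', mul_assoc]
    · rw [f, f', mul_assoc]

/-! ### The limit as all four variables tend to 0 -/

theorem norm_veryWellPoisedTerm_nat_le {q a : ℂ} {ε : ℝ} (hq : ‖q‖ < 1) (hε : 0 < ε)
    (ha : ‖a‖ * ε < 1) :
    ∃ C, ∀ x y z w, ‖x‖ ≤ ε → ‖y‖ ≤ ε → ‖z‖ ≤ ε → ‖w‖ ≤ ε → ∀ n : ℕ,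
      ‖veryWellPoisedTerm q a x y z w n‖ ≤ C * (‖a‖ ^ 2 * ‖q‖ * (2 * ε) ^ 4) ^ n := by
  obtain ⟨C, hC, hb⟩ := norm_wellPoisedNat_le_uniform q a hq hε.le ha
    (show ε < 2 * ε by linarith)
  refine ⟨(1 + ‖a‖) * C ^ 4, fun x y z w hx hy hz hw n => ?_⟩
  simp only [veryWellPoisedTerm, wellPoisedProd, wellPoisedFactor_natCast, zpow_natCast]
  simp only [norm_mul, norm_pow]
  rw [← pow_mul]
  calc _ ≤ (1 + ‖a‖) * ((‖a‖ ^ 2 * ‖q‖) ^ n * ((C * (2 * ε) ^ n) * (C * (2 * ε) ^ n) *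
        (C * (2 * ε) ^ n) * (C * (2 * ε) ^ n))) := by
        gcongr
        exacts [norm_one_sub_mul_pow_le hq a _, hb x hx n, hb y hy n, hb z hz n, hb w hw n]
    _ = _ := by simp only [mul_pow, ← pow_mul]; ring

theorem exists_summable_bound_veryWellPoisedTerm {q a : ℂ} (hq0 : q ≠ 0) (hq : ‖q‖ < 1)
    (ha : a ≠ 0) :
    ∃ ε > 0, ∃ b : ℤ → ℝ, Summable b ∧ ∀ x y z w, ‖x‖ ≤ ε → ‖y‖ ≤ ε → ‖z‖ ≤ ε → ‖w‖ ≤ ε →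
      ∀ n, ‖veryWellPoisedTerm q a x y z w n‖ ≤ b n := by
  have t1 : Tendsto (fun ε : ℝ => ‖a‖ * ε) (𝓝[>] 0) (𝓝 (‖a‖ * 0)) :=
    Tendsto.mono_left (Continuous.tendsto (by fun_prop) 0) nhdsWithin_le_nhds
  have t2 : Tendsto (fun ε : ℝ => ε) (𝓝[>] 0) (𝓝 0) :=
    Tendsto.mono_left (Continuous.tendsto (by fun_prop) 0) nhdsWithin_le_nhds
  have t3 : Tendsto (fun ε : ℝ => ‖a‖ ^ 2 * ‖q‖ * (2 * ε) ^ 4) (𝓝[>] 0)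
      (𝓝 (‖a‖ ^ 2 * ‖q‖ * (2 * 0) ^ 4)) :=
    Tendsto.mono_left (Continuous.tendsto (by fun_prop) 0) nhdsWithin_le_nhds
  -- The bound ‖a‖ε < 1 controls the denominators for n ≥ 0, and ε < 1 is the same condition after
  -- the reflection (a, ε) ↦ (a⁻¹, ‖a‖ε). The third condition makes the geometric ratio, common to
  -- both tails, less than 1.
  obtain ⟨ε, ⟨⟨h1, h2⟩, h3⟩, hε⟩ := (((t1.eventually_lt_const (u := 1) (by simp)).and
    (t2.eventually_lt_const (u := 1) (by simp))).and
    (t3.eventually_lt_const (u := 1) (by simp))).and self_mem_nhdsWithin |>.exists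
  have hε : 0 < ε := hε
  have ha' : 0 < ‖a‖ := norm_pos_iff.2 ha
  obtain ⟨C, hC⟩ := norm_veryWellPoisedTerm_nat_le hq hε h1
  obtain ⟨C', hC'⟩ := norm_veryWellPoisedTerm_nat_le (q := q) (a := a⁻¹) (ε := ‖a‖ * ε) hq
    (by positivity) (by rw [norm_inv, inv_mul_cancel_left₀ ha'.ne']; exact h2)
  have e : ‖a⁻¹‖ ^ 2 * ‖q‖ * (2 * (‖a‖ * ε)) ^ 4 = ‖a‖ ^ 2 * ‖q‖ * (2 * ε) ^ 4 := by
    rw [norm_inv]; field_simp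
  rw [e] at hC'
  set ρ := ‖a‖ ^ 2 * ‖q‖ * (2 * ε) ^ 4 with hρ
  have hρ0 : 0 ≤ ρ := by positivity
  have hg : Summable fun n : ℕ => (|C| + ‖a‖ * |C'|) * ρ ^ n :=
    (summable_geometric_of_lt_one hρ0 h3).mul_left _
  refine ⟨ε, hε, fun n => (|C| + ‖a‖ * |C'|) * ρ ^ n.natAbs,
    Summable.of_nat_of_neg (by simpa using hg) (by simpa using hg),
    fun x y z w hx hy hz hw n => ?_⟩
  beta_reduce
  obtain ⟨m, rfl | rfl⟩ := n.eq_nat_or_neg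
  · rw [Int.natAbs_natCast]
    refine (hC x y z w hx hy hz hw m).trans ?_
    gcongr
    have : 0 ≤ ‖a‖ * |C'| := by positivity
    linarith [le_abs_self C]
  · rw [Int.natAbs_neg, Int.natAbs_natCast, veryWellPoisedTerm_neg hq0 ha, norm_mul, norm_neg]
    have hb : ∀ {u : ℂ}, ‖u‖ ≤ ε → ‖a * u‖ ≤ ‖a‖ * ε := fun hu => by
      rw [norm_mul]; gcongr
    calc _ ≤ ‖a‖ * (C' * ρ ^ m) := by
          gcongr
          exact hC' _ _ _ _ (hb hx) (hb hy) (hb hz) (hb hw) m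
      _ = ‖a‖ * C' * ρ ^ m := by ring
      _ ≤ _ := by
          gcongr
          have : ‖a‖ * C' ≤ ‖a‖ * |C'| := by gcongr; exact le_abs_self _
          linarith [abs_nonneg C]

theorem tendsto_veryWellPoisedSum {q a : ℂ} (hq0 : q ≠ 0) (hq : ‖q‖ < 1) (ha : a ≠ 0)
    {x y z w : ℕ → ℂ} (hx : Tendsto x atTop (𝓝 0)) (hy : Tendsto y atTop (𝓝 0))
    (hz : Tendsto z atTop (𝓝 0)) (hw : Tendsto w atTop (𝓝 0)) :
    Tendsto (fun M => veryWellPoisedSum q a (x M) (y M) (z M) (w M)) atTop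
      (𝓝 (veryWellPoisedSum q a 0 0 0 0)) := by
  obtain ⟨ε, hε, b, hb, hbound⟩ := exists_summable_bound_veryWellPoisedTerm hq0 hq ha
  refine tendsto_tsum_of_dominated_convergence hb (fun n => ?_) ?_
  · simp only [veryWellPoisedTerm, wellPoisedProd]
    exact ((((tendsto_wellPoisedFactor hx n).mul (tendsto_wellPoisedFactor hy n)).mul
      (tendsto_wellPoisedFactor hz n)).mul (tendsto_wellPoisedFactor hw n)).const_mul _
      |>.const_mul _
  · have hsmall : ∀ {u : ℕ → ℂ}, Tendsto u atTop (𝓝 0) → ∀ᶠ M in atTop, ‖u M‖ ≤ ε := fun hu => by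
      have := hu.norm
      rw [norm_zero] at this
      exact this.eventually_le_const hε
    filter_upwards [hsmall hx, hsmall hy, hsmall hz, hsmall hw] with M h1 h2 h3 h4
    exact hbound _ _ _ _ h1 h2 h3 h4

theorem tendsto_wellPoisedDenom {q : ℂ} (hq : ‖q‖ < 1) (a : ℂ)
    {x y z w : ℕ → ℂ} (hx : Tendsto x atTop (𝓝 0)) (hy : Tendsto y atTop (𝓝 0))
    (hz : Tendsto z atTop (𝓝 0)) (hw : Tendsto w atTop (𝓝 0)) :
    Tendsto (fun M => wellPoisedDenom q a (x M) (y M) (z M) (w M)) atTop (𝓝 1) := by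
  have hc : ∀ {u : ℕ → ℂ} (c : ℂ), Tendsto u atTop (𝓝 0) →
      Tendsto (fun M => qShiftedInf (c * u M) q) atTop (𝓝 1) := fun c hu =>
    tendsto_qShiftedInf hq (by simpa using hu.const_mul c)
  have h := ((((hc (a * q) hx).mul (hc (a * q) hy)).mul (hc (a * q) hz)).mul
    (hc (a * q) hw)).mul ((((hc q hx).mul (hc q hy)).mul (hc q hz)).mul (hc q hw)) |>.mul
    (hc (a ^ 2 * q) (by simpa using ((hx.mul hy).mul hz).mul hw))
  simpa [wellPoisedDenom] using h

theorem tendsto_wellPoisedNumer {q : ℂ} (hq : ‖q‖ < 1) (a : ℂ)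
    {x y z w : ℕ → ℂ} (hx : Tendsto x atTop (𝓝 0)) (hy : Tendsto y atTop (𝓝 0))
    (hz : Tendsto z atTop (𝓝 0)) (hw : Tendsto w atTop (𝓝 0)) :
    Tendsto (fun M => wellPoisedNumer q a (x M) (y M) (z M) (w M)) atTop (𝓝 1) := by
  have hc : ∀ {u v : ℕ → ℂ}, Tendsto u atTop (𝓝 0) → Tendsto v atTop (𝓝 0) →
      Tendsto (fun M => qShiftedInf (a * q * (u M * v M)) q) atTop (𝓝 1) := fun hu hv =>
    tendsto_qShiftedInf hq (by simpa using (hu.mul hv).const_mul (a * q))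
  have h := ((((hc hx hy).mul (hc hx hz)).mul (hc hx hw)).mul (hc hy hz)).mul (hc hy hw) |>.mul
    (hc hz hw)
  simpa [wellPoisedNumer] using h

theorem veryWellPoisedSum_mul_denom {q a x y z w : ℂ} (hq0 : q ≠ 0) (hq : ‖q‖ < 1) (ha : a ≠ 0)
    (hr : WellPoisedRegular₄ q a x y z w) (h : ‖a ^ 2 * q * (x * y * z * w)‖ < 1) :
    veryWellPoisedSum q a x y z w * wellPoisedDenom q a x y z w =
      veryWellPoisedSum q a 0 0 0 0 * wellPoisedNumer q a x y z w := by
  have hs : ∀ u : ℂ, Tendsto (fun M : ℕ => q ^ M * u) atTop (𝓝 0) := fun u => by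
    simpa using (tendsto_pow_atTop_nhds_zero_of_norm_lt_one hq).mul_const u
  -- Cross-multiplication eliminates C without dividing by N, which may be 0.
  have key : ∀ M : ℕ, veryWellPoisedSum q a x y z w * wellPoisedDenom q a x y z w *
      wellPoisedNumer q a (q ^ M * x) (q ^ M * y) (q ^ M * z) (q ^ M * w) =
      (veryWellPoisedSum q a (q ^ M * x) (q ^ M * y) (q ^ M * z) (q ^ M * w) *
        wellPoisedDenom q a (q ^ M * x) (q ^ M * y) (q ^ M * z) (q ^ M * w)) *
        wellPoisedNumer q a x y z w := fun M => by
    obtain ⟨-, C, e, f⟩ := exists_factor_shift_pow hq0 hq ha hr h M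
    rw [e, f]; ring
  have l1 := (tendsto_wellPoisedNumer hq a (hs x) (hs y) (hs z) (hs w)).const_mul
    (veryWellPoisedSum q a x y z w * wellPoisedDenom q a x y z w)
  have l2 := ((tendsto_veryWellPoisedSum hq0 hq ha (hs x) (hs y) (hs z) (hs w)).mul
    (tendsto_wellPoisedDenom hq a (hs x) (hs y) (hs z) (hs w))).mul_const
    (wellPoisedNumer q a x y z w)
  simp only [key] at l1
  simpa using tendsto_nhds_unique l1 l2

/-! ### Evaluation of the constant and Bailey's sum -/

theorem wellPoisedNat_one_succ (q a : ℂ) (n : ℕ) : wellPoisedNat q a 1 (n + 1) = 0 :=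
  prod_eq_zero (mem_range.2 n.succ_pos) (by simp)

/-- A form of the Jacobi triple product identity. -/
theorem veryWellPoisedSum_zero {q a : ℂ} (hq0 : q ≠ 0) (hq : ‖q‖ < 1) (ha : a ≠ 0)
    (h1 : ∀ k : ℕ, a * q ^ (k + 1) ≠ 1) (h2 : ∀ k : ℕ, a⁻¹ * q ^ (k + 1) ≠ 1) :
    veryWellPoisedSum q a 0 0 0 0 =
      (1 - a) * qShiftedInf (a * q) q * qShiftedInf (q / a) q * qShiftedInf q q := by
  have hqk : ∀ k : ℕ, q ^ (k + 1) ≠ 1 := fun k hk => by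
    have := pow_lt_one₀ (norm_nonneg q) hq k.succ_ne_zero
    rw [← norm_pow, hk, norm_one] at this
    exact lt_irrefl _ this
  -- The value x = 1 kills every term with n > 0, and y = a⁻¹, its mirror image under reflection,
  -- kills every term with n < 0.
  have hr : WellPoisedRegular₄ q a 1 a⁻¹ 0 0 :=
    ⟨fun k => ⟨by simpa using hqk k, by simpa using h1 k⟩,
      fun k => ⟨h2 k, by simpa [mul_inv_cancel₀ ha] using hqk k⟩,
      WellPoisedRegular.zero q a, WellPoisedRegular.zero q a⟩
  have key := veryWellPoisedSum_mul_denom hq0 hq ha hr (by simp)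
  have hS : veryWellPoisedSum q a 1 a⁻¹ 0 0 = 1 - a := by
    unfold veryWellPoisedSum
    rw [tsum_eq_single 0]
    · have e : ∀ x, wellPoisedFactor q a x 0 = 1 := fun x => by
        change wellPoisedNat q a x 0 = 1
        simp [wellPoisedNat]
      simp [veryWellPoisedTerm, wellPoisedProd, e]
    · intro n hn
      cases n with
      | ofNat n =>
        cases n with
        | zero => exact absurd rfl hn
        | succ n =>
          have : wellPoisedFactor q a 1 (Int.ofNat (n + 1)) = 0 := wellPoisedNat_one_succ q a n
          simp only [veryWellPoisedTerm, wellPoisedProd, this, zero_mul, mul_zero]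
      | negSucc n =>
        have : wellPoisedFactor q a a⁻¹ (Int.negSucc n) = 0 := by
          simp [wellPoisedFactor, mul_inv_cancel₀ ha, wellPoisedNat_one_succ]
        simp only [veryWellPoisedTerm, wellPoisedProd, this, zero_mul, mul_zero]
  -- Here N reduces to (q; q)_∞, while D contains its square, so one copy cancels.
  have hne : qShiftedInf q q ≠ 0 := qShiftedInf_ne_zero hq fun k => by
    rw [← pow_succ']; exact hqk k
  have e1 : a * q * a⁻¹ = q := by field_simp
  simp only [hS, wellPoisedDenom, wellPoisedNumer, mul_zero, mul_one,
    one_mul, qShiftedInf_zero, e1] at key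
  rw [← div_eq_mul_inv] at key
  rw [← mul_left_inj' hne]
  linear_combination -key

/-- Bailey's `₆ψ₆` summation in terms of reciprocal parameters. -/
theorem veryWellPoisedSum_eq {q a x y z w : ℂ} (hq0 : q ≠ 0) (hq : ‖q‖ < 1) (ha : a ≠ 0)
    (h1 : ∀ k : ℕ, a * q ^ (k + 1) ≠ 1) (h2 : ∀ k : ℕ, a⁻¹ * q ^ (k + 1) ≠ 1)
    (hr : WellPoisedRegular₄ q a x y z w) (h : ‖a ^ 2 * q * (x * y * z * w)‖ < 1) :
    veryWellPoisedSum q a x y z w =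
      (1 - a) * (qShiftedInf (a * q) q * qShiftedInf (q / a) q * qShiftedInf q q *
        wellPoisedNumer q a x y z w / wellPoisedDenom q a x y z w) := by
  have hD : wellPoisedDenom q a x y z w ≠ 0 := by
    have n1 : ∀ {u}, WellPoisedRegular q a u → qShiftedInf (a * q * u) q ≠ 0 := fun hu =>
      qShiftedInf_ne_zero hq fun k => by convert (hu k).2 using 1; ring
    have n2 : ∀ {u}, WellPoisedRegular q a u → qShiftedInf (q * u) q ≠ 0 := fun hu =>
      qShiftedInf_ne_zero hq fun k => by convert (hu k).1 using 1; ring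
    have n3 : qShiftedInf (a ^ 2 * q * (x * y * z * w)) q ≠ 0 :=
      qShiftedInf_ne_zero hq fun k hk => by
        have := congrArg norm hk
        rw [norm_mul, norm_pow, norm_one] at this
        have h3 := pow_le_one₀ (n := k) (norm_nonneg q) hq.le
        have h4 := pow_nonneg (norm_nonneg q) k
        nlinarith [norm_nonneg (a ^ 2 * q * (x * y * z * w))]
    obtain ⟨hx, hy, hz, hw⟩ := hr
    simp only [wellPoisedDenom, ne_eq, mul_eq_zero, not_or]
    exact ⟨⟨⟨⟨⟨n1 hx, n1 hy⟩, n1 hz⟩, n1 hw⟩, ⟨⟨n2 hx, n2 hy⟩, n2 hz⟩, n2 hw⟩, n3⟩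
  rw [← mul_div_assoc, eq_div_iff hD, veryWellPoisedSum_mul_denom hq0 hq ha hr h,
    veryWellPoisedSum_zero hq0 hq ha h1 h2]
  ring

/-! ### From ψ-series terms to well-poised terms -/

theorem qShifted_natCast (a q : ℂ) (n : ℕ) :
    qShifted a q n = ∏ k ∈ range n, (1 - a * q ^ k) := rfl

theorem qShifted_neg (a q : ℂ) (n : ℕ) :
    qShifted a q (-(n : ℤ)) = (∏ k ∈ range n, (1 - a * q ^ (-((k : ℤ) + 1))))⁻¹ := by
  cases n with
  | zero =>
    change ∏ k ∈ range 0, (1 - a * q ^ k) = _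
    simp
  | succ n => rfl

theorem qShifted_div_eq_wellPoisedFactor {q a x : ℂ} (hq : q ≠ 0) (ha : a ≠ 0) (hx : x ≠ 0)
    (h : WellPoisedRegular q a x) (n : ℤ) :
    qShifted x⁻¹ q n / qShifted (a * q * x) q n = (x ^ n)⁻¹ * wellPoisedFactor q a x n := by
  obtain ⟨m, rfl | rfl⟩ := n.eq_nat_or_neg
  · rw [qShifted_natCast, qShifted_natCast, wellPoisedFactor_natCast, zpow_natCast, ← inv_pow,
      wellPoisedNat, ← prod_div_distrib, ← card_range m, ← prod_const, card_range,
      ← prod_mul_distrib]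
    refine prod_congr rfl fun k _ => ?_
    have h1 := h.den_ne_zero k
    rw [show 1 - a * q * x * q ^ k = 1 - a * x * q ^ (k + 1) by ring]
    field_simp
  · rw [qShifted_neg, qShifted_neg, wellPoisedFactor_neg, zpow_neg, zpow_natCast, inv_inv,
      ← mul_assoc, ← mul_pow, wellPoisedNat, inv_div_inv, ← prod_div_distrib]
    conv_rhs => rw [← card_range m, ← prod_const, card_range, ← prod_mul_distrib]
    refine prod_congr rfl fun k _ => ?_
    have h1 := h.one_sub_ne_zero k
    rw [inv_mul_cancel_left₀ ha, zpow_neg, ← Nat.cast_succ, zpow_natCast, Nat.succ_eq_add_one]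
    have h2 : 1 - x⁻¹ * (q ^ (k + 1))⁻¹ ≠ 0 := by
      contrapose! h1
      have hqk : q ^ (k + 1) ≠ 0 := pow_ne_zero _ hq
      field_simp at h1
      linear_combination -h1
    have hqk : q ^ k ≠ 0 := pow_ne_zero _ hq
    rw [← mul_div_assoc, div_eq_div_iff h2 h1, pow_succ]
    field_simp
    ring

/-- The quotient telescopes. Used for c and -c together, it produces the very-well-poised factor (1
- c²q^(2n)) / (1 - c²). -/
theorem qShifted_mul_div {q c : ℂ} (hq : q ≠ 0) (hc : ∀ n : ℤ, c * q ^ n ≠ 1) (n : ℤ) :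
    qShifted (c * q) q n / qShifted c q n = (1 - c * q ^ n) / (1 - c) := by
  have hc' : ∀ n : ℤ, 1 - c * q ^ n ≠ 0 := fun n => sub_ne_zero.2 (hc n).symm
  have hc0 : 1 - c ≠ 0 := by simpa using hc' 0
  obtain ⟨m, rfl | rfl⟩ := n.eq_nat_or_neg
  · rw [qShifted_natCast, qShifted_natCast, ← prod_div_distrib, zpow_natCast]
    induction m with
    | zero => simp [hc0]
    | succ m ih =>
      have h1 : 1 - c * q ^ m ≠ 0 := by simpa using hc' m
      rw [prod_range_succ, ih]
      field_simp
      ring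
  · rw [qShifted_neg, qShifted_neg, inv_div_inv, ← prod_div_distrib]
    induction m with
    | zero => simp [hc0]
    | succ m ih =>
      have h1 := hc' (-(m : ℤ))
      have e : c * q * q ^ (-((m : ℤ) + 1)) = c * q ^ (-(m : ℤ)) := by
        rw [neg_add, zpow_add₀ hq, zpow_neg_one]; field_simp
      rw [prod_range_succ, ih, e, Nat.cast_succ]
      field_simp

theorem qPsiTerm_six {q a c x y z w b₁ b₂ b₃ b₄ d₁ d₂ d₃ d₄ Z : ℂ} (hq : q ≠ 0) (ha : a ≠ 0)
    (hac : a = c ^ 2) (hc : ∀ n : ℤ, c * q ^ n ≠ 1) (hc' : ∀ n : ℤ, -c * q ^ n ≠ 1)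
    (hr : WellPoisedRegular₄ q a x y z w) (hx : x ≠ 0) (hy : y ≠ 0) (hz : z ≠ 0) (hw : w ≠ 0)
    (hb₁ : b₁ = x⁻¹) (hb₂ : b₂ = y⁻¹) (hb₃ : b₃ = z⁻¹) (hb₄ : b₄ = w⁻¹)
    (hd₁ : d₁ = a * q * x) (hd₂ : d₂ = a * q * y) (hd₃ : d₃ = a * q * z) (hd₄ : d₄ = a * q * w)
    (hZ : Z = a ^ 2 * q * (x * y * z * w)) (n : ℤ) :
    qPsiTerm [c * q, -(c * q), b₁, b₂, b₃, b₄] [c, -c, d₁, d₂, d₃, d₄] q Z n =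
      (1 - a)⁻¹ * veryWellPoisedTerm q a x y z w n := by
  subst hb₁ hb₂ hb₃ hb₄ hd₁ hd₂ hd₃ hd₄ hZ
  have e1 := qShifted_mul_div hq hc n
  have e2 := qShifted_mul_div hq hc' n
  have ex := qShifted_div_eq_wellPoisedFactor hq ha hx hr.1 n
  have ey := qShifted_div_eq_wellPoisedFactor hq ha hy hr.2.1 n
  have ez := qShifted_div_eq_wellPoisedFactor hq ha hz hr.2.2.1 n
  have ew := qShifted_div_eq_wellPoisedFactor hq ha hw hr.2.2.2 n
  rw [neg_mul] at e2
  have hxn := zpow_ne_zero n hx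
  have hyn := zpow_ne_zero n hy
  have hzn := zpow_ne_zero n hz
  have hwn := zpow_ne_zero n hw
  calc _ = (qShifted (c * q) q n / qShifted c q n) * (qShifted (-(c * q)) q n / qShifted (-c) q n) *
        (qShifted x⁻¹ q n / qShifted (a * q * x) q n) *
        (qShifted y⁻¹ q n / qShifted (a * q * y) q n) *
        (qShifted z⁻¹ q n / qShifted (a * q * z) q n) *
        (qShifted w⁻¹ q n / qShifted (a * q * w) q n) * (a ^ 2 * q * (x * y * z * w)) ^ n := by
        simp only [qPsiTerm, qShiftedList, List.map_cons, List.map_nil, List.prod_cons,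
          List.prod_nil, List.length_cons, List.length_nil, sub_self, zpow_zero, mul_one]
        simp only [div_eq_mul_inv, mul_inv]
        ring
    _ = _ := by
        rw [e1, e2, ex, ey, ez, ew, mul_zpow _ (x * y * z * w), mul_zpow _ w, mul_zpow _ z,
          mul_zpow x y, div_mul_div_comm, show (1 - c) * (1 - -c) = 1 - a by rw [hac]; ring,
          veryWellPoisedTerm, wellPoisedProd, hac]
        field_simp
        ring

/-- When aqxy = 1, the denominator 1 - axq^(k+1) equals (y - q^k)/y, and likewise with x and y
exchanged. Each factor's denominators cancel the other's numerators. -/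
theorem wellPoisedFactor_mul_eq {q a x y : ℂ} (hq : q ≠ 0)
    (hx : ∀ n : ℤ, x * q ^ n ≠ 1) (hy : ∀ n : ℤ, y * q ^ n ≠ 1) (h : a * q * (x * y) = 1) (n : ℤ) :
    wellPoisedFactor q a x n * wellPoisedFactor q a y n = (x * y) ^ n := by
  have key : ∀ {a x y : ℂ}, a * q * (x * y) = 1 → (∀ k : ℕ, x ≠ q ^ k) → (∀ k : ℕ, y ≠ q ^ k) →
      ∀ n : ℕ, wellPoisedNat q a x n * wellPoisedNat q a y n = (x * y) ^ n := by
    intro a x y h hx hy n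
    have hxy : x * y ≠ 0 := right_ne_zero_of_mul_eq_one h
    have hx0 := left_ne_zero_of_mul hxy
    have hy0 := right_ne_zero_of_mul hxy
    rw [wellPoisedNat, wellPoisedNat, ← prod_mul_distrib]
    conv_rhs => rw [← card_range n, ← prod_const]
    refine prod_congr rfl fun k _ => ?_
    have h1 : x - q ^ k ≠ 0 := sub_ne_zero.2 (hx k)
    have h2 : y - q ^ k ≠ 0 := sub_ne_zero.2 (hy k)
    have e1 : 1 - a * x * q ^ (k + 1) = (y - q ^ k) / y := by
      field_simp; linear_combination -q ^ k * h
    have e2 : 1 - a * y * q ^ (k + 1) = (x - q ^ k) / x := by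
      field_simp; linear_combination -q ^ k * h
    rw [e1, e2]
    field_simp
  have hpow : ∀ {u : ℂ}, (∀ n : ℤ, u * q ^ n ≠ 1) → ∀ k : ℤ, u ≠ q ^ k := fun hu k e =>
    hu (-k) (by rw [e, ← zpow_add₀ hq, add_neg_cancel, zpow_zero])
  obtain ⟨m, rfl | rfl⟩ := n.eq_nat_or_neg
  · rw [wellPoisedFactor_natCast, wellPoisedFactor_natCast, zpow_natCast]
    exact key h (fun k => by simpa using hpow hx k) (fun k => by simpa using hpow hy k) m
  · have hxy : x * y ≠ 0 := right_ne_zero_of_mul_eq_one h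
    have haux : ∀ {u v : ℂ}, a * q * (u * v) = 1 → (∀ n : ℤ, v * q ^ n ≠ 1) →
        ∀ k : ℕ, a * u ≠ q ^ k := fun {u v} huv hv k e => hv (k + 1) (by
      rw [zpow_add_one₀ hq, zpow_natCast, ← e]; linear_combination huv)
    have e := key (a := a⁻¹) (x := a * x) (y := a * y) (by field_simp; linear_combination h)
      (haux h hy) (haux (by rw [mul_comm y x]; exact h) hx) m
    rw [wellPoisedFactor_neg, wellPoisedFactor_neg, zpow_neg, zpow_natCast, ← inv_pow,
      -- Multiplied by xy, the right side is (aqxy)² = 1.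
      show (x * y)⁻¹ = q * q * (a * x * (a * y)) from inv_eq_of_mul_eq_one_right (by
        linear_combination (a * q * (x * y) + 1) * h), mul_pow, mul_pow, ← e]
    ring

theorem qPsiTerm_four {q a c x y z w b₃ b₄ d₃ d₄ Z : ℂ} (hq : q ≠ 0) (ha : a ≠ 0)
    (hac : a = c ^ 2) (hc : ∀ n : ℤ, c * q ^ n ≠ 1) (hc' : ∀ n : ℤ, -c * q ^ n ≠ 1)
    (hx : ∀ n : ℤ, x * q ^ n ≠ 1) (hy : ∀ n : ℤ, y * q ^ n ≠ 1) (hxy : a * q * (x * y) = 1)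
    (hr₃ : WellPoisedRegular q a z) (hr₄ : WellPoisedRegular q a w) (hz : z ≠ 0) (hw : w ≠ 0)
    (hb₃ : b₃ = z⁻¹) (hb₄ : b₄ = w⁻¹) (hd₃ : d₃ = a * q * z) (hd₄ : d₄ = a * q * w)
    (hZ : Z = a * (z * w)) (n : ℤ) :
    qPsiTerm [c * q, -(c * q), b₃, b₄] [c, -c, d₃, d₄] q Z n =
      (1 - a)⁻¹ * veryWellPoisedTerm q a x y z w n := by
  subst hb₃ hb₄ hd₃ hd₄ hZ
  have e1 := qShifted_mul_div hq hc n
  have e2 := qShifted_mul_div hq hc' n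
  have ez := qShifted_div_eq_wellPoisedFactor hq ha hz hr₃ n
  have ew := qShifted_div_eq_wellPoisedFactor hq ha hw hr₄ n
  have exy := wellPoisedFactor_mul_eq hq hx hy hxy n
  rw [neg_mul] at e2
  have hzn := zpow_ne_zero n hz
  have hwn := zpow_ne_zero n hw
  have hA : (a ^ 2 * q) ^ n * (x * y) ^ n = a ^ n := by
    rw [← mul_zpow]; congr 1; linear_combination a * hxy
  calc _ = (qShifted (c * q) q n / qShifted c q n) * (qShifted (-(c * q)) q n / qShifted (-c) q n) *
        (qShifted z⁻¹ q n / qShifted (a * q * z) q n) *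
        (qShifted w⁻¹ q n / qShifted (a * q * w) q n) * (a * (z * w)) ^ n := by
        simp only [qPsiTerm, qShiftedList, List.map_cons, List.map_nil, List.prod_cons,
          List.prod_nil, List.length_cons, List.length_nil, sub_self, zpow_zero, mul_one]
        simp only [div_eq_mul_inv, mul_inv]
        ring
    _ = _ := by
        rw [e1, e2, ez, ew, mul_zpow a, mul_zpow z, div_mul_div_comm,
          show (1 - c) * (1 - -c) = 1 - a by rw [hac]; ring,
          veryWellPoisedTerm, wellPoisedProd, exy, ← hA, hac]
        field_simp
        ring

/-! ### Nonvanishing of denominators and the specialisations -/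

/-- Multiplication by the positive real q^n preserves the sign of the real part. This covers the
imaginary parameters and the negative reals a and a⁻¹. -/
theorem mul_pow_ne_one_of_re_nonpos {q : ℝ} (hq : 0 < q) {u : ℂ} (hu : u.re ≤ 0) (n : ℤ) :
    u * (q : ℂ) ^ n ≠ 1 := fun h => by
  have h1 := congrArg Complex.re h
  rw [← Complex.ofReal_zpow, Complex.re_mul_ofReal, Complex.one_re] at h1
  nlinarith [zpow_pos hq n]

theorem wellPoisedRegular_of_re_nonpos {q : ℝ} (hq : 0 < q) {a x : ℂ} (hx : x.re ≤ 0)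
    (hax : (a * x).re ≤ 0) : WellPoisedRegular q a x := fun k =>
  ⟨by simpa only [← zpow_natCast] using mul_pow_ne_one_of_re_nonpos hq hx _,
    by simpa only [← zpow_natCast] using mul_pow_ne_one_of_re_nonpos hq hax _⟩

end BilateralSummation

theorem mainTheorem8 (q α : ℝ) (hq0 : 0 < q) (hq1 : q < 1) (hα : α ≠ 0)
    (t₁ t₂ : ℂ) (ht₁ : t₁ ≠ 0) (ht₂ : t₂ ≠ 0)
    -- no denominator factor of the two series vanishes
    (h₁ : ∀ k : ℕ, t₁ * α * q ^ k ≠ 1) (h₂ : ∀ k : ℕ, t₂ * α * q ^ k ≠ 1)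
    (h₃ : ∀ k : ℕ, -t₁ / α * q ^ k ≠ 1) (h₄ : ∀ k : ℕ, -t₂ / α * q ^ k ≠ 1) :
    (∀ β : ℝ, 0 < β → ‖t₁ * t₂ * β / q‖ < 1 →
      Summable (qPsiTerm
        [Complex.I * α * q, -(Complex.I * α * q),
          Complex.I * α / Real.sqrt β, -(Complex.I * α / Real.sqrt β),
          -(α * q / t₁), -(α * q / t₂)]
        [Complex.I * α, -(Complex.I * α),
          Complex.I * α * Real.sqrt β * q, -(Complex.I * α * Real.sqrt β * q),
          t₁ * α, t₂ * α]
        q (t₁ * t₂ * β / q)) ∧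
      qPsi
        [Complex.I * α * q, -(Complex.I * α * q),
          Complex.I * α / Real.sqrt β, -(Complex.I * α / Real.sqrt β),
          -(α * q / t₁), -(α * q / t₂)]
        [Complex.I * α, -(Complex.I * α),
          Complex.I * α * Real.sqrt β * q, -(Complex.I * α * Real.sqrt β * q),
          t₁ * α, t₂ * α]
        q (t₁ * t₂ * β / q) =
      qShiftedInfList
        [Complex.I * t₁ * Real.sqrt β, -(Complex.I * t₁ * Real.sqrt β),
          Complex.I * t₂ * Real.sqrt β, -(Complex.I * t₂ * Real.sqrt β),
          -(t₁ * t₂ / q), -((α : ℂ) ^ 2 * q), -(q / (α : ℂ) ^ 2), -((β : ℂ) * q), q] q /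
      qShiftedInfList
        [t₁ * α, t₂ * α, -t₁ / α, -t₂ / α, t₁ * t₂ * β / q,
          Complex.I * α * Real.sqrt β * q, -(Complex.I * α * Real.sqrt β * q),
          Complex.I * Real.sqrt β * q / α, -(Complex.I * Real.sqrt β * q / α)] q) ∧
    (‖t₁ * t₂ / (q : ℂ) ^ 2‖ < 1 →
      Summable (qPsiTerm
        [Complex.I * α * q, -(Complex.I * α * q), -(α * q / t₁), -(α * q / t₂)]
        [Complex.I * α, -(Complex.I * α), α * t₁, α * t₂]
        q (-(t₁ * t₂ / (q : ℂ) ^ 2))) ∧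
      qPsi
        [Complex.I * α * q, -(Complex.I * α * q), -(α * q / t₁), -(α * q / t₂)]
        [Complex.I * α, -(Complex.I * α), α * t₁, α * t₂]
        q (-(t₁ * t₂ / (q : ℂ) ^ 2)) = 0) := by
  have hqC : (q : ℂ) ≠ 0 := Complex.ofReal_ne_zero.2 hq0.ne'
  have hαC : (α : ℂ) ≠ 0 := Complex.ofReal_ne_zero.2 hα
  have hqn : ‖(q : ℂ)‖ < 1 := by
    rw [Complex.norm_real, Real.norm_of_nonneg hq0.le]; exact hq1
  have hI := Complex.I_ne_zero
  have hα2 : 0 < α ^ 2 := by positivity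
  set a : ℂ := -(α : ℂ) ^ 2 with ha_def
  have ha : a ≠ 0 := neg_ne_zero.2 (pow_ne_zero 2 hαC)
  have haR : a = ((-α ^ 2 : ℝ) : ℂ) := by rw [ha_def]; push_cast; ring
  have hac : a = (Complex.I * α) ^ 2 := by rw [mul_pow, Complex.I_sq, ha_def]; ring
  have hare : a.re ≤ 0 := by rw [haR, Complex.ofReal_re]; linarith
  have haire : (a⁻¹).re ≤ 0 := by
    rw [haR, ← Complex.ofReal_inv, Complex.ofReal_re, inv_nonpos]; linarith
  have hc : ∀ n : ℤ, Complex.I * α * (q : ℂ) ^ n ≠ 1 :=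
    mul_pow_ne_one_of_re_nonpos hq0 (by simp)
  have hc' : ∀ n : ℤ, -(Complex.I * α) * (q : ℂ) ^ n ≠ 1 :=
    mul_pow_ne_one_of_re_nonpos hq0 (by simp)
  have ha1 : 1 - a ≠ 0 := fun h => by
    rw [← sub_eq_zero.1 h] at hare; norm_num at hare
  have hk1 : ∀ k : ℕ, a * (q : ℂ) ^ (k + 1) ≠ 1 := fun k => by
    simpa only [← zpow_natCast] using mul_pow_ne_one_of_re_nonpos hq0 hare _
  have hk2 : ∀ k : ℕ, a⁻¹ * (q : ℂ) ^ (k + 1) ≠ 1 := fun k => by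
    simpa only [← zpow_natCast] using mul_pow_ne_one_of_re_nonpos hq0 haire _
  -- The variable u = -t/(αq) is the reciprocal of -αq/t. Since qu = -t/α and aqu = tα, its
  -- regularity is exactly the pair of hypotheses on t.
  have hreg : ∀ t : ℂ, (∀ k : ℕ, t * α * (q : ℂ) ^ k ≠ 1) → (∀ k : ℕ, -t / α * (q : ℂ) ^ k ≠ 1) →
      WellPoisedRegular q a (-(t / (α * q))) := fun t ht ht' k => by
    refine ⟨?_, ?_⟩
    · convert ht' k using 1
      rw [pow_succ]; field_simp
    · convert ht k using 1
      rw [ha_def]; field_simp; ring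
  have hz : WellPoisedRegular q a (-(t₁ / (α * q))) := hreg t₁ h₁ h₃
  have hw : WellPoisedRegular q a (-(t₂ / (α * q))) := hreg t₂ h₂ h₄
  have hz0 : -(t₁ / (α * q)) ≠ 0 := neg_ne_zero.2 (div_ne_zero ht₁ (mul_ne_zero hαC hqC))
  have hw0 : -(t₂ / (α * q)) ≠ 0 := neg_ne_zero.2 (div_ne_zero ht₂ (mul_ne_zero hαC hqC))
  refine ⟨fun β hβ hconv => ?_, fun hconv => ?_⟩
  · have hs0 : 0 < Real.sqrt β := Real.sqrt_pos.2 hβ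
    have hsC : (Real.sqrt β : ℂ) ≠ 0 := Complex.ofReal_ne_zero.2 hs0.ne'
    have hsq : (β : ℂ) = (Real.sqrt β : ℂ) ^ 2 := by
      rw [← Complex.ofReal_pow, Real.sq_sqrt hβ.le]
    rw [hsq] at hconv ⊢
    generalize Real.sqrt β = s at *
    have hI2 := Complex.I_sq
    -- With s = √β, the variables ∓is/α are the reciprocals of ±iα/s, and aq times them gives ±iαsq.
    have hx0 : -(Complex.I * s / α) ≠ 0 := neg_ne_zero.2 (div_ne_zero (mul_ne_zero hI hsC) hαC)
    have hy0 : Complex.I * s / α ≠ 0 := div_ne_zero (mul_ne_zero hI hsC) hαC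
    have hre : (Complex.I * s / (α : ℂ)).re = 0 := by simp
    have hre' : (a * (Complex.I * s / (α : ℂ))).re = 0 := by
      rw [haR, Complex.re_ofReal_mul, hre, mul_zero]
    have hx : WellPoisedRegular q a (-(Complex.I * s / α)) :=
      wellPoisedRegular_of_re_nonpos hq0 (by rw [Complex.neg_re, hre, neg_zero])
        (by rw [mul_neg, Complex.neg_re, hre', neg_zero])
    have hy : WellPoisedRegular q a (Complex.I * s / α) :=
      wellPoisedRegular_of_re_nonpos hq0 hre.le hre'.le
    have hZ : t₁ * t₂ * (s : ℂ) ^ 2 / q = a ^ 2 * q * (-(Complex.I * s / α) *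
        (Complex.I * s / α) * -(t₁ / (α * q)) * -(t₂ / (α * q))) := by
      rw [ha_def]; field_simp; rw [hI2]; ring
    have hterm := qPsiTerm_six (Z := t₁ * t₂ * (s : ℂ) ^ 2 / q)
      (b₁ := Complex.I * α / s) (b₂ := -(Complex.I * α / s))
      (b₃ := -(α * q / t₁)) (b₄ := -(α * q / t₂))
      (d₁ := Complex.I * α * s * q) (d₂ := -(Complex.I * α * s * q))
      (d₃ := t₁ * α) (d₄ := t₂ * α) hqC ha hac hc hc' ⟨hx, hy, hz, hw⟩ hx0 hy0 hz0 hw0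
      (by field_simp; rw [hI2]) (by field_simp; rw [hI2]; ring) (by field_simp) (by field_simp)
      (by rw [ha_def]; field_simp) (by rw [ha_def]; field_simp)
      (by rw [ha_def]; field_simp) (by rw [ha_def]; field_simp) hZ
    rw [hZ] at hconv
    have hsum := summable_veryWellPoisedTerm hqC hqn ha hconv
    refine ⟨(hsum.mul_left _).congr fun n => (hterm n).symm, ?_⟩
    have hval := veryWellPoisedSum_eq hqC hqn ha hk1 hk2 ⟨hx, hy, hz, hw⟩ hconv
    rw [qPsi, tsum_congr hterm, tsum_mul_left]
    change (1 - a)⁻¹ * veryWellPoisedSum _ _ _ _ _ _ = _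
    rw [hval, inv_mul_cancel_left₀ ha1]
    simp only [qShiftedInfList, List.map_cons, List.map_nil, List.prod_cons, List.prod_nil,
      wellPoisedNumer, wellPoisedDenom, ← hZ]
    rw [show a * q * (-(Complex.I * s / α) * (Complex.I * s / α)) = -((s : ℂ) ^ 2 * q) by
        rw [ha_def]; field_simp; rw [hI2],
      show a * q * (-(Complex.I * s / α) * -(t₁ / (α * q))) = -(Complex.I * t₁ * s) by
        rw [ha_def]; field_simp,
      show a * q * (-(Complex.I * s / α) * -(t₂ / (α * q))) = -(Complex.I * t₂ * s) by
        rw [ha_def]; field_simp,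
      show a * q * (Complex.I * s / α * -(t₁ / (α * q))) = Complex.I * t₁ * s by
        rw [ha_def]; field_simp,
      show a * q * (Complex.I * s / α * -(t₂ / (α * q))) = Complex.I * t₂ * s by
        rw [ha_def]; field_simp,
      show a * q * (-(t₁ / (α * q)) * -(t₂ / (α * q))) = -(t₁ * t₂ / q) by
        rw [ha_def]; field_simp,
      show a * q * -(Complex.I * s / α) = Complex.I * α * s * q by rw [ha_def]; field_simp,
      show a * q * (Complex.I * s / α) = -(Complex.I * α * s * q) by rw [ha_def]; field_simp,
      show a * q * -(t₁ / (α * q)) = t₁ * α by rw [ha_def]; field_simp,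
      show a * q * -(t₂ / (α * q)) = t₂ * α by rw [ha_def]; field_simp,
      show q * -(Complex.I * s / α) = -(Complex.I * s * q / α) by ring,
      show q * (Complex.I * s / α) = Complex.I * s * q / α by ring,
      show q * -(t₁ / (α * q)) = -t₁ / α by field_simp,
      show q * -(t₂ / (α * q)) = -t₂ / α by field_simp,
      show a * q = -((α : ℂ) ^ 2 * q) by rw [ha_def]; ring,
      show q / a = -(q / (α : ℂ) ^ 2) by rw [ha_def, div_neg]]
    congr 1 <;> ring
  · have hI2 := Complex.I_sq
    -- The auxiliary pair i, i/(α²q) satisfies aqxy = 1. Formally this is β = -1/q in (i), but that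
    -- choice gives the real pair ±1/(α√q), which could meet a power of q; an imaginary pair cannot.
    have hyre : (Complex.I / ((α : ℂ) ^ 2 * q)).re = 0 := by
      rw [← Complex.ofReal_pow, ← Complex.ofReal_mul, Complex.div_ofReal_re, Complex.I_re,
        zero_div]
    have hreg' : ∀ u : ℂ, u.re = 0 → WellPoisedRegular q a u := fun u hu =>
      wellPoisedRegular_of_re_nonpos hq0 hu.le
        (by rw [haR, Complex.re_ofReal_mul, hu, mul_zero])
    have hxy : a * q * (Complex.I * (Complex.I / ((α : ℂ) ^ 2 * q))) = 1 := by
      rw [ha_def]; field_simp; rw [hI2]; ring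
    have hZ : -(t₁ * t₂ / (q : ℂ) ^ 2) = a * (-(t₁ / (α * q)) * -(t₂ / (α * q))) := by
      rw [ha_def]; field_simp
    have hterm := qPsiTerm_four (Z := -(t₁ * t₂ / (q : ℂ) ^ 2))
      (b₃ := -(α * q / t₁)) (b₄ := -(α * q / t₂)) (d₃ := α * t₁) (d₄ := α * t₂) hqC ha hac hc hc'
      (mul_pow_ne_one_of_re_nonpos hq0 Complex.I_re.le)
      (mul_pow_ne_one_of_re_nonpos hq0 hyre.le) hxy hz hw hz0 hw0
      (by field_simp) (by field_simp) (by rw [ha_def]; field_simp) (by rw [ha_def]; field_simp) hZ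
    have hconv' : ‖a ^ 2 * q * (Complex.I * (Complex.I / ((α : ℂ) ^ 2 * q)) *
        -(t₁ / (α * q)) * -(t₂ / (α * q)))‖ < 1 := by
      rw [← norm_neg (t₁ * t₂ / (q : ℂ) ^ 2), hZ] at hconv
      refine lt_of_eq_of_lt (congrArg norm ?_) hconv
      linear_combination a * (-(t₁ / (α * q)) * -(t₂ / (α * q))) * hxy
    have hsum := summable_veryWellPoisedTerm hqC hqn ha hconv'
    refine ⟨(hsum.mul_left _).congr fun n => (hterm n).symm, ?_⟩
    have hval := veryWellPoisedSum_eq hqC hqn ha hk1 hk2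
      ⟨hreg' _ Complex.I_re, hreg' _ hyre, hz, hw⟩ hconv'
    rw [qPsi, tsum_congr hterm, tsum_mul_left]
    change (1 - a)⁻¹ * veryWellPoisedSum _ _ _ _ _ _ = _
    -- The numerator factor (aqxy; q)_∞ becomes (1; q)_∞ = 0.
    rw [hval, wellPoisedNumer, hxy, qShiftedInf_one hqn]
    simp only [zero_mul, mul_zero, zero_div]
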